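/- Let $n\ge 1$ and let $\mathbb{R}^{2n}=\mathbb{R}^2\times\dots\times\mathbb{R}^2$ have coordinates $(x_1,y_1,\dots,x_n,y_n)$ and the standard symplectic form $\omega_0=\sum_{i=1}^n dx_i\wedge dy_i$. Let $B^2(\rho)\subset\mathbb{R}^2$ denote the closed disk of radius $\rho$ centred at the origin, and put $P^{2n}(\delta,\dots,\delta)=B^2(\delta)\times\dots\times B^2(\delta)$ ($n$ factors). Let $r>0$ and let $$D=\{0\}\times[-r,r]\times B^2(r)\times\dots\times B^2(r)\subset\mathbb{R}^{2n}$$ with $n-1$ factors $B^2(r)$. Then for all $\varepsilon>0$ and $\delta>0$ there is a Hamiltonian symplectomorphism $\psi$ of $(\mathbb{R}^{2n},\omega_0)$ with support in $$Q=[-\varepsilon,\varepsilon]\times[-r-\varepsilon,r+\varepsilon]\times B^2(r+\varepsilon)\times\dots\times B^2(r+\varepsilon)$$ such that $\psi(D)\subset P^{2n}(\delta,\dots,\delta)$. Here a Hamiltonian symplectomorphism with support in the compact set $Q$ is a smooth diffeomorphism $\psi$ of $\mathbb{R}^{2n}$ with $\psi^*\omega_0=\omega_0$ and $\overline{\{z:\psi(z)\ne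 z\}}\subset Q$ that is the time-one map of the flow of the vector fields $X_{H_t}$, given by $\omega_0(X_{H_t},\cdot)=dH_t$, for some smooth time-dependent Hamiltonian $H_t\colon\mathbb{R}^{2n}\to\mathbb{R}$, $t\in[0,1]$, with $\operatorname{supp}H_t\subset Q$ for all $t$. -/

import Mathlib

open scoped ContDiff

/-- The space `ℝ²ⁿ = ℝ² × ⋯ × ℝ²` with coordinates `(x₁, y₁, …, xₙ, yₙ)`: the `i`-th factor of a
point `z` is the pair `z i = (xᵢ, yᵢ)`. -/
abbrev StdSpace (n : ℕ) : Type := Fin n → ℝ × ℝ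

/-- The standard symplectic form `ω₀ = ∑ᵢ dxᵢ ∧ dyᵢ`. -/
def stdSymplecticForm {n : ℕ} (u v : StdSpace n) : ℝ :=
  ∑ i, ((u i).1 * (v i).2 - (u i).2 * (v i).1)

/-- The Hamiltonian vector field `X_F = ∑ᵢ (∂F/∂yᵢ) ∂/∂xᵢ - (∂F/∂xᵢ) ∂/∂yᵢ` of a function `F`. -/
noncomputable def hamiltonianVectorField {n : ℕ} (F : StdSpace n → ℝ) (z : StdSpace n) :
    StdSpace n :=
  fun i => (fderiv ℝ F z (Pi.single i (0, 1)), -fderiv ℝ F z (Pi.single i (1, 0)))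

/-- `X_F` is the vector field with `ω₀(X_F, ·) = dF`. -/
theorem stdSymplecticForm_hamiltonianVectorField {n : ℕ} (F : StdSpace n → ℝ)
    (z v : StdSpace n) :
    stdSymplecticForm (hamiltonianVectorField F z) v = fderiv ℝ F z v := by
  have hv : v = ∑ i, ((v i).1 • Pi.single (M := fun _ : Fin n => ℝ × ℝ) i ((1 : ℝ), (0 : ℝ))
      + (v i).2 • Pi.single (M := fun _ : Fin n => ℝ × ℝ) i ((0 : ℝ), (1 : ℝ))) := by
    funext j
    rw [Finset.sum_apply, Finset.sum_eq_single j]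
    · simp
    · intro b _ hb
      simp [Pi.single_eq_of_ne hb.symm]
    · simp
  conv_rhs => rw [hv]
  rw [map_sum]
  refine Finset.sum_congr rfl fun i _ => ?_
  rw [map_add, map_smul, map_smul, smul_eq_mul, smul_eq_mul]
  simp only [hamiltonianVectorField]
  ring

/-- A symplectomorphism of `(ℝ²ⁿ, ω₀)`: a smooth diffeomorphism `ψ` with `ψ^* ω₀ = ω₀`. -/
structure IsSymplectomorphism {n : ℕ} (ψ : StdSpace n ≃ StdSpace n) : Prop where
  contDiff : ContDiff ℝ ∞ ψ
  contDiff_symm : ContDiff ℝ ∞ ψ.symm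
  preserves : ∀ z u v : StdSpace n,
    stdSymplecticForm (fderiv ℝ ψ z u) (fderiv ℝ ψ z v) = stdSymplecticForm u v

/-- `ψ` is the time-one map of the flow `Φ_t` of the Hamiltonian vector fields `X_{H_t}` of a smooth
time-dependent Hamiltonian `H_t`, `t ∈ [0, 1]`, all of whose members are supported in `K`.
(The set `K` is meant to be compact.) -/
def IsHamiltonianTimeOneMap {n : ℕ} (K : Set (StdSpace n)) (ψ : StdSpace n → StdSpace n) : Prop :=
  ∃ (H : ℝ → StdSpace n → ℝ) (Φ : ℝ → StdSpace n → StdSpace n),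
    ContDiff ℝ ∞ (fun p : ℝ × StdSpace n => H p.1 p.2) ∧
    (∀ t ∈ Set.Icc (0 : ℝ) 1, tsupport (H t) ⊆ K) ∧
    (∀ z, Φ 0 z = z) ∧
    (∀ z, ∀ t ∈ Set.Icc (0 : ℝ) 1,
      HasDerivWithinAt (fun s => Φ s z) (hamiltonianVectorField (H t) (Φ t z))
        (Set.Icc (0 : ℝ) 1) t) ∧
    ∀ z, Φ 1 z = ψ z

/-- A Hamiltonian symplectomorphism of `(ℝ²ⁿ, ω₀)` with support in the compact set `K`: it is
generated by a Hamiltonian supported in `K`, and the closure of the set of points that it moves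
is contained in `K`. -/
structure IsHamiltonianSymplectomorphismIn {n : ℕ} (K : Set (StdSpace n))
    (ψ : StdSpace n ≃ StdSpace n) : Prop where
  isSymplectomorphism : IsSymplectomorphism ψ
  isHamiltonian : IsHamiltonianTimeOneMap K ψ
  support_subset : closure {z | ψ z ≠ z} ⊆ K

/-- The closed disk `B²(r)` of radius `r` in the plane, for the Euclidean norm. -/
def disk2 (r : ℝ) : Set (ℝ × ℝ) := {p | p.1 ^ 2 + p.2 ^ 2 ≤ r ^ 2}

/-- The polydisk `P²ⁿ(r₁, …, rₙ) = B²(r₁) × ⋯ × B²(rₙ)`. -/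
def polydisk {n : ℕ} (r : Fin n → ℝ) : Set (StdSpace n) := {z | ∀ i, z i ∈ disk2 (r i)}

/-- The codimension-one disk `{0} × [-r, r] × B²(r) × ⋯ × B²(r)`. -/
def thinDisk (n : ℕ) [NeZero n] (r : ℝ) : Set (StdSpace n) :=
  {z | (z 0).1 = 0 ∧ (z 0).2 ∈ Set.Icc (-r) r ∧ ∀ i, i ≠ 0 → z i ∈ disk2 r}

/-- The box `[-a, a] × [-b, b] × B²(b) × ⋯ × B²(b)`. -/
def box (n : ℕ) [NeZero n] (a b : ℝ) : Set (StdSpace n) :=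
  {z | (z 0).1 ∈ Set.Icc (-a) a ∧ (z 0).2 ∈ Set.Icc (-b) b ∧ ∀ i, i ≠ 0 → z i ∈ disk2 b}

-- Explicit Hamiltonian flows, each supported in the box, crush `thinDisk n r` towards the origin.
-- The flow of `C x₀ y₀` preserves `{x₀ = 0}` and multiplies `y₀` there by `exp (-C)`, so it pushes
-- the disk close to `{0} × B²(r)ⁿ⁻¹`.
--
-- Each remaining disk is then flattened, using the `0`-th plane as auxiliary space. Starting from
-- `z₀ = 0`, the flow of `y₀ g(xᵢ)` with `g(q) = √(2(c - q)/N)` moves `x₀` to `g(xᵢ)`, which records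
-- `xᵢ` in the size of `z₀`: now `N|z₀|²/2 - c = -xᵢ`. The flow of `(N|z₀|²/2 - c) yᵢ` rotates `z₀`,
-- fixes `yᵢ` and gives `xᵢ` the constant velocity `-xᵢ(0)`, so `xᵢ = 0` at time one. Finally `C xᵢ
-- yᵢ` contracts `yᵢ`. For large `N` the radius of `z₀` stays small throughout
-- (`exists_hamiltonian_squeeze_factor`).
--
-- The small errors are absorbed by choosing the maps in reverse order: once the later maps are
-- known, continuity and compactness fix the accuracy needed from the earlier ones.
--
-- These flows are cut off outside a smaller box, which leaves the trajectories used unchanged. The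
-- rest shows that a compactly supported Hamiltonian has a smooth symplectic time-one map, and that
-- such maps compose.

universe u

/-! ### Smooth dependence of flows on initial conditions, via the integral equation on a space of
curves. -/

section SmoothDependence

/-- The pointwise evaluation pairing of continuous families of linear maps and of vectors. -/
noncomputable def evalPairing (K E F : Type*) [TopologicalSpace K] [CompactSpace K]
    [NormedAddCommGroup E] [NormedSpace ℝ E] [NormedAddCommGroup F] [NormedSpace ℝ F] :
    C(K, E →L[ℝ] F) →L[ℝ] C(K, E) →L[ℝ] C(K, F) :=
  LinearMap.mkContinuous₂
    (LinearMap.mk₂ ℝ (fun (A : C(K, E →L[ℝ] F)) (β : C(K, E)) =>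
        (⟨fun t => A t (β t), by fun_prop⟩ : C(K, F)))
      (fun _ _ _ => by ext; simp) (fun _ _ _ => by ext; simp)
      (fun _ _ _ => by ext; simp) (fun _ _ _ => by ext; simp)) 1
    (fun A β => by
      rw [one_mul]
      refine (ContinuousMap.norm_le _ (mul_nonneg (norm_nonneg A) (norm_nonneg β))).2 fun t => ?_
      exact ((A t).le_opNorm (β t)).trans
        (mul_le_mul (A.norm_coe_le_norm t) (β.norm_coe_le_norm t) (norm_nonneg _) (norm_nonneg _)))

/-- The mean value inequality bounds the pointwise Taylor remainder by the oscillation of `g'`;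
uniform continuity makes this bound independent of `t`, as the sup norm requires. -/
theorem hasFDerivAt_comp_left {K E F : Type*} [TopologicalSpace K] [CompactSpace K]
    [NormedAddCommGroup E] [NormedSpace ℝ E] [NormedAddCommGroup F] [NormedSpace ℝ F]
    (g : C(E, F)) (g' : C(E, E →L[ℝ] F)) (hg : ∀ x, HasFDerivAt g (g' x) x)
    (hu : UniformContinuous g') (α : C(K, E)) :
    HasFDerivAt (fun α : C(K, E) => g.comp α) (evalPairing K E F (g'.comp α)) α := by
  rw [hasFDerivAt_iff_isLittleO_nhds_zero, Asymptotics.isLittleO_iff]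
  intro c hc
  obtain ⟨d, hd, h⟩ := Metric.uniformContinuous_iff.1 hu c hc
  filter_upwards [Metric.ball_mem_nhds (0 : C(K, E)) hd] with β hβ
  rw [mem_ball_zero_iff] at hβ
  rw [ContinuousMap.norm_le _ (by positivity)]
  intro t
  have hβt : ‖β t‖ < d := (β.norm_coe_le_norm t).trans_lt hβ
  have key := (convex_ball (α t) d).norm_image_sub_le_of_norm_hasFDerivWithin_le' (C := c)
    (f := g) (f' := g') (φ := g' (α t)) (x := α t) (y := α t + β t)
    (fun x _ => (hg x).hasFDerivWithinAt)
    (fun x hx => by rw [← dist_eq_norm]; exact (h hx).le)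
    (Metric.mem_ball_self hd) (by simpa [Metric.mem_ball, dist_eq_norm] using hβt)
  rw [add_sub_cancel_left] at key
  exact key.trans (mul_le_mul_of_nonneg_left (β.norm_coe_le_norm t) hc.le)

/-- The derivative of postcomposition by `g` is postcomposition by `fderiv ℝ g` followed by a
continuous linear map. The target `F` varies in the induction because the next map takes values in
`E →L[ℝ] F`; compact support supplies uniform continuity at each order. -/
theorem contDiff_comp_left {K : Type*} {E : Type u} [TopologicalSpace K] [CompactSpace K]
    [NormedAddCommGroup E] [NormedSpace ℝ E] (n : ℕ) :
    ∀ {F : Type u} [NormedAddCommGroup F] [NormedSpace ℝ F] (g : C(E, F)),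
      ContDiff ℝ ∞ g → HasCompactSupport g → ContDiff ℝ n (fun α : C(K, E) => g.comp α) := by
  induction n with
  | zero =>
    intro F _ _ g _ _
    rw [CharP.cast_eq_zero, contDiff_zero]
    exact ContinuousMap.continuous_postcomp g
  | succ n ih =>
    intro F _ _ g hg hs
    have hg' : ContDiff ℝ ∞ (fderiv ℝ g) := hg.fderiv_right (by simp)
    let g' : C(E, E →L[ℝ] F) := ⟨fderiv ℝ g, hg'.continuous⟩
    have hs' : HasCompactSupport g' := hs.fderiv ℝ
    have hd := hasFDerivAt_comp_left (K := K) g g'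
      (fun x => (hg.differentiable (by simp) x).hasFDerivAt)
      (hs'.uniformContinuous_of_continuous g'.continuous)
    rw [Nat.cast_add, Nat.cast_one, contDiff_succ_iff_fderiv]
    refine ⟨fun α => (hd α).differentiableAt, fun h => by simp at h, ?_⟩
    rw [show fderiv ℝ (fun α : C(K, E) => g.comp α)
      = fun α => evalPairing K E F (g'.comp α) from funext fun α => (hd α).fderiv]
    exact (evalPairing K E F).contDiff.comp (ih g' hg' hs')

theorem exists_contDiff_inverse_id_sub {X : Type*} [NormedAddCommGroup X] [NormedSpace ℝ X]
    [CompleteSpace X] {R : X → X} {K : NNReal} (hR : ContDiff ℝ ∞ R) (hL : LipschitzWith K R)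
    (hK : K < 1) : ∃ S : X → X, ContDiff ℝ ∞ S ∧ ∀ x, S x - R (S x) = x := by
  have happ : ApproximatesLinearOn (fun x => x - R x)
      ((ContinuousLinearEquiv.refl ℝ X : X ≃L[ℝ] X) : X →L[ℝ] X) Set.univ K := by
    intro x _ y _
    have h := hL.dist_le_mul y x
    rw [dist_eq_norm, dist_eq_norm, norm_sub_rev y x] at h
    rwa [show R y - R x = x - R x - (y - R y) - (x - y) by abel] at h
  have hc : Subsingleton X ∨
      K < ‖((ContinuousLinearEquiv.refl ℝ X).symm : X →L[ℝ] X)‖₊⁻¹ := by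
    rcases subsingleton_or_nontrivial X with h | h
    · exact Or.inl h
    · right
      have : ‖((ContinuousLinearEquiv.refl ℝ X).symm : X →L[ℝ] X)‖₊ = 1 := by
        rw [ContinuousLinearEquiv.refl_symm, ContinuousLinearEquiv.coe_refl]
        exact NNReal.eq (by simp)
      rw [this, inv_one]
      exact hK
  let e := happ.toHomeomorph _ hc
  have he : ∀ x, e x = x - R x := fun x => rfl
  -- The derivative of `R` has norm below one, so a Neumann series inverts `1 - R'` and the inverse
  -- homeomorphism is smooth.
  have hA : ∀ a, ‖fderiv ℝ R a‖ < 1 := fun a =>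
    (norm_fderiv_le_of_lipschitz ℝ hL).trans_lt (by exact_mod_cast hK)
  refine ⟨e.symm, ?_, fun x => by rw [← he, e.apply_symm_apply]⟩
  refine Homeomorph.contDiff_symm e
    (f₀' := fun a => ContinuousLinearEquiv.unitsEquiv ℝ X (Units.oneSub _ (hA a))) ?_ ?_
  · intro a
    exact (hasFDerivAt_id a).sub (hR.differentiable (by simp) a).hasFDerivAt
  · exact contDiff_id.sub hR

/-- The Volterra operator `α ↦ ∫₀ᵗ α` on continuous curves. -/
noncomputable def volterra (E : Type*) [NormedAddCommGroup E] [NormedSpace ℝ E] :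
    C(Set.Icc (0 : ℝ) 1, E) →L[ℝ] C(Set.Icc (0 : ℝ) 1, E) :=
  LinearMap.mkContinuous
    { toFun := fun α => ⟨fun t => ∫ s in (0 : ℝ)..t, α.IccExtend zero_le_one s,
        (intervalIntegral.continuous_primitive
          (fun a b => (α.IccExtend zero_le_one).continuous.intervalIntegrable a b) 0).comp
          continuous_subtype_val⟩
      map_add' := fun α β => by
        ext t
        exact intervalIntegral.integral_add
          ((α.IccExtend zero_le_one).continuous.intervalIntegrable _ _)
          ((β.IccExtend zero_le_one).continuous.intervalIntegrable _ _)
      map_smul' := fun c α => by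
        ext t
        exact intervalIntegral.integral_smul c _ } 1
    (fun α => by
      rw [ContinuousMap.norm_le _ (by positivity), one_mul]
      intro t
      refine (intervalIntegral.norm_integral_le_of_norm_le_const (C := ‖α‖)
        fun s _ => α.norm_coe_le_norm _).trans ?_
      rw [sub_zero, abs_of_nonneg t.2.1]
      exact mul_le_of_le_one_right (norm_nonneg _) t.2.2)

theorem volterra_apply {E : Type*} [NormedAddCommGroup E] [NormedSpace ℝ E]
    (α : C(Set.Icc (0 : ℝ) 1, E)) (t : Set.Icc (0 : ℝ) 1) :
    volterra E α t = ∫ s in (0 : ℝ)..t, α.IccExtend zero_le_one s := rfl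

theorem norm_volterra_le {E : Type*} [NormedAddCommGroup E] [NormedSpace ℝ E] :
    ‖volterra E‖ ≤ 1 := LinearMap.mkContinuous_norm_le _ zero_le_one _

theorem hasDerivWithinAt_of_eq_volterra {E : Type*} [NormedAddCommGroup E] [NormedSpace ℝ E]
    [CompleteSpace E] {f : ℝ → E} {z : E} {α : C(Set.Icc (0 : ℝ) 1, E)}
    (h : ∀ t : Set.Icc (0 : ℝ) 1, f t = z + volterra E α t) (t : Set.Icc (0 : ℝ) 1) :
    HasDerivWithinAt f (α t) (Set.Icc 0 1) t := by
  have hc := (α.IccExtend (zero_le_one (α := ℝ))).continuous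
  have hd : HasDerivAt (fun u => z + ∫ s in (0 : ℝ)..u, α.IccExtend zero_le_one s) (α t) t := by
    have := (intervalIntegral.integral_hasDerivAt_right (hc.intervalIntegrable 0 t)
      hc.aestronglyMeasurable.stronglyMeasurableAtFilter hc.continuousAt).const_add z
    rwa [show α.IccExtend zero_le_one (t : ℝ) = α t from Set.IccExtend_val _ _ t] at this
  exact hd.hasDerivWithinAt.congr (fun s hs => h ⟨s, hs⟩) (h t)

/-- The flow of a smooth compactly supported vector field with small Lipschitz constant exists up
to time one, is smooth in the initial condition, and its derivative solves the linearized
equation. -/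
theorem exists_contDiff_flow {E : Type u} [NormedAddCommGroup E] [NormedSpace ℝ E]
    [CompleteSpace E] {V : E → E} {K : NNReal} (hV : ContDiff ℝ ∞ V) (hs : HasCompactSupport V)
    (hL : LipschitzWith K V) (hK : K < 1) :
    ∃ Φ : ℝ → E → E, (∀ z, Φ 0 z = z) ∧ (∀ t ∈ Set.Icc (0 : ℝ) 1, ContDiff ℝ ∞ (Φ t)) ∧
      (∀ z, ∀ t ∈ Set.Icc (0 : ℝ) 1,
        HasDerivWithinAt (fun s => Φ s z) (V (Φ t z)) (Set.Icc 0 1) t) ∧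
      ∀ z u, ∀ t ∈ Set.Icc (0 : ℝ) 1, HasDerivWithinAt (fun s => fderiv ℝ (Φ s) z u)
        (fderiv ℝ V (Φ t z) (fderiv ℝ (Φ t) z u)) (Set.Icc 0 1) t := by
  let I := Set.Icc (0 : ℝ) 1
  let g : C(E, E) := ⟨V, hV.continuous⟩
  have hg' : ContDiff ℝ ∞ (fderiv ℝ V) := hV.fderiv_right (by simp)
  let g' : C(E, E →L[ℝ] E) := ⟨fderiv ℝ V, hg'.continuous⟩
  let N : C(I, E) → C(I, E) := fun α => g.comp α
  have hN : ContDiff ℝ ∞ N := contDiff_infty.2 fun n => contDiff_comp_left n g hV hs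
  have hNd : ∀ α, HasFDerivAt N (evalPairing I E E (g'.comp α)) α :=
    hasFDerivAt_comp_left g g' (fun x => (hV.differentiable (by simp) x).hasFDerivAt)
      ((hs.fderiv ℝ).uniformContinuous_of_continuous g'.continuous)
  have hNL : LipschitzWith K N := LipschitzWith.of_dist_le_mul fun α β => by
    rw [ContinuousMap.dist_le (by positivity)]
    intro t
    exact (hL.dist_le_mul _ _).trans
      (mul_le_mul_of_nonneg_left (ContinuousMap.dist_apply_le_dist t) K.2)
  have hRL : LipschitzWith K (fun α => volterra E (N α)) := by
    have := ((volterra E).lipschitz.weaken (K' := 1) norm_volterra_le).comp hNL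
    rwa [one_mul] at this
  -- The integral equation `α = z + ∫ V(α)` reads `(id - R) α = const z`, with `R` the Volterra
  -- operator after `N`. A smooth inverse of `id - R` therefore yields the whole trajectory as a
  -- smooth function of `z`.
  obtain ⟨S₀, hS₀, hS₀'⟩ := exists_contDiff_inverse_id_sub
    ((volterra E).contDiff.comp hN) hRL hK
  let cst : E →L[ℝ] C(I, E) := LinearMap.mkContinuous
    { toFun := fun z => ContinuousMap.const I z, map_add' := fun _ _ => rfl,
      map_smul' := fun _ _ => rfl } 1
    (fun z => by
      rw [ContinuousMap.norm_le _ (by positivity), one_mul]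
      exact fun _ => le_rfl)
  let S : E → C(I, E) := fun z => S₀ (cst z)
  have hS : ContDiff ℝ ∞ S := hS₀.comp cst.contDiff
  have hSe : ∀ z, S z = cst z + volterra E (N (S z)) := fun z =>
    sub_eq_iff_eq_add.1 (hS₀' (cst z))
  let Φ : ℝ → E → E := fun t z => S z (Set.projIcc 0 1 zero_le_one t)
  have hΦ : ∀ (t : I), Φ t = fun z => S z t := fun t => by
    funext z
    exact congrArg (S z) (Set.projIcc_val zero_le_one t)
  have hSf : ∀ z, HasFDerivAt S (fderiv ℝ S z) z := fun z =>
    (hS.differentiable (by simp) z).hasFDerivAt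
  -- Differentiating the fixed-point equation in `z` gives the integral form of the linearized
  -- equation.
  have hSd : ∀ z u, fderiv ℝ S z u =
      cst u + volterra E (evalPairing I E E (g'.comp (S z)) (fderiv ℝ S z u)) := by
    intro z u
    have h1 : HasFDerivAt S (cst + (volterra E).comp
        ((evalPairing I E E (g'.comp (S z))).comp (fderiv ℝ S z))) z := by
      have := cst.hasFDerivAt.add
        ((volterra E).hasFDerivAt.comp z ((hNd (S z)).comp z (hSf z)))
      exact this.congr_of_eventuallyEq (Filter.Eventually.of_forall hSe)
    exact congrArg (fun A : E →L[ℝ] C(I, E) => A u) ((hSf z).unique h1)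
  have hΦd : ∀ (t : I) z u, fderiv ℝ (Φ t) z u = fderiv ℝ S z u t := fun t z u => by
    rw [hΦ]
    exact congrArg (fun A : E →L[ℝ] E => A u)
      (((ContinuousMap.evalCLM ℝ t).hasFDerivAt.comp z (hSf z)).fderiv)
  refine ⟨Φ, fun z => ?_, fun t ht => ?_, fun z t ht => ?_, fun z u t ht => ?_⟩
  · have := congrArg (fun α : C(I, E) => α ⟨0, Set.left_mem_Icc.2 zero_le_one⟩) (hSe z)
    have h2 : Φ 0 z = S z ⟨0, Set.left_mem_Icc.2 zero_le_one⟩ := congrFun (hΦ ⟨0, Set.left_mem_Icc.2 zero_le_one⟩) z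
    rw [h2]
    refine this.trans ?_
    rw [ContinuousMap.add_apply, volterra_apply, intervalIntegral.integral_same, add_zero]
    rfl
  · rw [hΦ ⟨t, ht⟩]
    exact (ContinuousMap.evalCLM ℝ (⟨t, ht⟩ : I)).contDiff.comp hS
  · have h := hasDerivWithinAt_of_eq_volterra (f := fun s => Φ s z) (z := z) (α := N (S z))
      (fun s => by
        rw [hΦ s]
        exact congrArg (fun α : C(I, E) => α s) (hSe z)) ⟨t, ht⟩
    rwa [show N (S z) ⟨t, ht⟩ = V (Φ t z) from congrArg V (congrFun (hΦ ⟨t, ht⟩) z).symm] at h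
  · have h := hasDerivWithinAt_of_eq_volterra (f := fun s => fderiv ℝ (Φ s) z u) (z := u)
      (α := evalPairing I E E (g'.comp (S z)) (fderiv ℝ S z u))
      (fun s => by
        rw [hΦd s]
        exact congrArg (fun α : C(I, E) => α s) (hSd z u)) ⟨t, ht⟩
    rw [hΦd ⟨t, ht⟩, hΦ ⟨t, ht⟩]
    exact h

end SmoothDependence

/-! ### Hamiltonian flows: symplecticity, inverses, composition and existence. -/

section HamiltonianFlows

theorem eq_of_integralCurve {E : Type*} [NormedAddCommGroup E] [NormedSpace ℝ E] {V : E → E}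
    {K : NNReal} (hL : LipschitzWith K V) {f g : ℝ → E}
    (hf : ∀ t ∈ Set.Icc (0 : ℝ) 1, HasDerivWithinAt f (V (f t)) (Set.Icc 0 1) t)
    (hg : ∀ t ∈ Set.Icc (0 : ℝ) 1, HasDerivWithinAt g (V (g t)) (Set.Icc 0 1) t)
    (h0 : f 0 = g 0) : f 1 = g 1 := by
  have aux : ∀ {f : ℝ → E},
      (∀ t ∈ Set.Icc (0 : ℝ) 1, HasDerivWithinAt f (V (f t)) (Set.Icc 0 1) t) →
      ∀ t ∈ Set.Ico (0 : ℝ) 1, HasDerivWithinAt f (V (f t)) (Set.Ici t) t := by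
    intro f hf t ht
    refine (hf t ⟨ht.1, ht.2.le⟩).mono_of_mem_nhdsWithin ?_
    exact Filter.mem_of_superset (Icc_mem_nhdsGE ht.2) (Set.Icc_subset_Icc_left ht.1)
  exact ODE_solution_unique (v := fun _ => V) (fun _ => hL)
    (fun t ht => (hf t ht).continuousWithinAt) (aux hf)
    (fun t ht => (hg t ht).continuousWithinAt) (aux hg) h0 (Set.right_mem_Icc.2 zero_le_one)

theorem hasDerivWithinAt_reverse {E : Type*} [NormedAddCommGroup E] [NormedSpace ℝ E]
    {f f' : ℝ → E} (hf : ∀ t ∈ Set.Icc (0 : ℝ) 1, HasDerivWithinAt f (f' t) (Set.Icc 0 1) t) :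
    ∀ t ∈ Set.Icc (0 : ℝ) 1,
      HasDerivWithinAt (fun s => f (1 - s)) (-f' (1 - t)) (Set.Icc 0 1) t := by
  have hm : Set.MapsTo (fun s : ℝ => 1 - s) (Set.Icc 0 1) (Set.Icc 0 1) :=
    fun s hs => ⟨by linarith [hs.2], by linarith [hs.1]⟩
  intro t ht
  have h := (hf (1 - t) (hm ht)).scomp t
    (((hasDerivAt_id t).const_sub 1).hasDerivWithinAt (s := Set.Icc 0 1)) hm
  rw [neg_one_smul] at h
  exact h

variable {n : ℕ}

/-- The linear map sending a covector to its `ω₀`-dual vector. -/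
noncomputable def symplecticDual (n : ℕ) : (StdSpace n →L[ℝ] ℝ) →L[ℝ] StdSpace n :=
  ContinuousLinearMap.pi fun i =>
    (ContinuousLinearMap.apply ℝ ℝ (Pi.single i (0, 1) : StdSpace n)).prod
      (-ContinuousLinearMap.apply ℝ ℝ (Pi.single i (1, 0) : StdSpace n))

theorem hamiltonianVectorField_eq_dual (F : StdSpace n → ℝ) (z : StdSpace n) :
    hamiltonianVectorField F z = symplecticDual n (fderiv ℝ F z) := rfl

theorem hamiltonianVectorField_congr {F G : StdSpace n → ℝ} {z : StdSpace n}
    (h : F =ᶠ[nhds z] G) : hamiltonianVectorField F z = hamiltonianVectorField G z := by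
  rw [hamiltonianVectorField_eq_dual, hamiltonianVectorField_eq_dual, h.fderiv_eq]

theorem hamiltonianVectorField_const_mul {F : StdSpace n → ℝ} (hF : Differentiable ℝ F) (a : ℝ)
    (z : StdSpace n) :
    hamiltonianVectorField (fun z => a * F z) z = a • hamiltonianVectorField F z := by
  rw [hamiltonianVectorField_eq_dual, hamiltonianVectorField_eq_dual, ← map_smul,
    fderiv_const_mul (hF z)]

theorem hamiltonianVectorField_add {F G : StdSpace n → ℝ} (hF : Differentiable ℝ F)
    (hG : Differentiable ℝ G) (z : StdSpace n) :
    hamiltonianVectorField (fun z => F z + G z) z =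
      hamiltonianVectorField F z + hamiltonianVectorField G z := by
  simp only [hamiltonianVectorField_eq_dual]
  rw [← map_add, fderiv_fun_add (hF z) (hG z)]

theorem contDiff_hamiltonianVectorField {F : StdSpace n → ℝ} (hF : ContDiff ℝ ∞ F) :
    ContDiff ℝ ∞ (hamiltonianVectorField F) :=
  (symplecticDual n).contDiff.comp (hF.fderiv_right (by simp))

theorem hasCompactSupport_hamiltonianVectorField {F : StdSpace n → ℝ}
    (hF : HasCompactSupport F) : HasCompactSupport (hamiltonianVectorField F) :=
  (hF.fderiv ℝ).comp_left (map_zero (symplecticDual n))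

theorem hamiltonianVectorField_eq_zero {F : StdSpace n → ℝ} {z : StdSpace n}
    (hz : z ∉ tsupport F) : hamiltonianVectorField F z = 0 := by
  rw [hamiltonianVectorField_eq_dual, fderiv_of_notMem_tsupport ℝ hz, map_zero]

theorem stdSymplecticForm_antisymm (u v : StdSpace n) :
    stdSymplecticForm u v = -stdSymplecticForm v u := by
  simp only [stdSymplecticForm, ← Finset.sum_neg_distrib]
  exact Finset.sum_congr rfl fun i _ => by ring

theorem HasDerivWithinAt.stdSymplecticForm {f g : ℝ → StdSpace n} {f' g' : StdSpace n}
    {s : Set ℝ} {t : ℝ} (hf : HasDerivWithinAt f f' s t) (hg : HasDerivWithinAt g g' s t) :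
    HasDerivWithinAt (fun t => stdSymplecticForm (f t) (g t))
      (stdSymplecticForm f' (g t) + stdSymplecticForm (f t) g') s t := by
  have hf1 := fun i => ((hasFDerivAt_fst (𝕜 := ℝ) (p := f t i)).comp_hasDerivWithinAt t
    (hasDerivWithinAt_pi.1 hf i))
  have hf2 := fun i => ((hasFDerivAt_snd (𝕜 := ℝ) (p := f t i)).comp_hasDerivWithinAt t
    (hasDerivWithinAt_pi.1 hf i))
  have hg1 := fun i => ((hasFDerivAt_fst (𝕜 := ℝ) (p := g t i)).comp_hasDerivWithinAt t
    (hasDerivWithinAt_pi.1 hg i))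
  have hg2 := fun i => ((hasFDerivAt_snd (𝕜 := ℝ) (p := g t i)).comp_hasDerivWithinAt t
    (hasDerivWithinAt_pi.1 hg i))
  have h := HasDerivWithinAt.fun_sum (u := Finset.univ) fun i _ =>
    ((hf1 i).mul (hg2 i)).sub ((hf2 i).mul (hg1 i))
  refine HasDerivWithinAt.congr_deriv (f := fun t => _root_.stdSymplecticForm (f t) (g t)) h ?_
  rw [_root_.stdSymplecticForm, _root_.stdSymplecticForm, ← Finset.sum_add_distrib]
  refine Finset.sum_congr rfl fun i _ => ?_
  simp only [ContinuousLinearMap.coe_fst', ContinuousLinearMap.coe_snd', Function.comp_apply]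
  ring

theorem stdSymplecticForm_fderiv_hamiltonianVectorField {F : StdSpace n → ℝ}
    (hF : ContDiff ℝ ∞ F) (z u v : StdSpace n) :
    stdSymplecticForm (fderiv ℝ (hamiltonianVectorField F) z u) v =
      fderiv ℝ (fderiv ℝ F) z u v := by
  have hd : Differentiable ℝ (fderiv ℝ F) :=
    (hF.fderiv_right (m := ∞) (by simp)).differentiable (by simp)
  have h1 : HasDerivAt (fun t : ℝ => hamiltonianVectorField F (z + t • u))
      (fderiv ℝ (hamiltonianVectorField F) z u) 0 :=
    ((contDiff_hamiltonianVectorField hF).differentiable (by simp) z).hasFDerivAt.hasLineDerivAt u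
  have h2 : HasDerivAt (fun t : ℝ => fderiv ℝ F (z + t • u)) (fderiv ℝ (fderiv ℝ F) z u) 0 :=
    (hd z).hasFDerivAt.hasLineDerivAt u
  have h3 := (h1.hasDerivWithinAt (s := Set.univ)).stdSymplecticForm
    (hasDerivWithinAt_const 0 Set.univ v)
  have h4 := h2.clm_apply (hasDerivAt_const (0 : ℝ) v)
  simp only [stdSymplecticForm_hamiltonianVectorField] at h3
  have h5 := h3.hasDerivAt Filter.univ_mem |>.unique h4
  simpa [stdSymplecticForm] using h5

/-- Symmetry of the Hessian of `F`: the two terms are `D²F(u, v)` and `-D²F(v, u)`. This makes `ω₀`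
of two transported vectors constant along the flow. -/
theorem stdSymplecticForm_linearization {F : StdSpace n → ℝ} (hF : ContDiff ℝ ∞ F)
    (z u v : StdSpace n) :
    stdSymplecticForm (fderiv ℝ (hamiltonianVectorField F) z u) v +
      stdSymplecticForm u (fderiv ℝ (hamiltonianVectorField F) z v) = 0 := by
  rw [stdSymplecticForm_antisymm u, stdSymplecticForm_fderiv_hamiltonianVectorField hF,
    stdSymplecticForm_fderiv_hamiltonianVectorField hF,
    (hF.contDiffAt.isSymmSndFDerivAt (by
      rw [minSmoothness_of_isRCLikeNormedField]
      exact WithTop.coe_le_coe.2 (le_top (a := (2 : ℕ∞))))) u v]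
  ring

/-- The flow of `-X_H` inverts the flow of `X_H`, because trajectories run backwards solve the
opposite equation and solutions are unique. The bound `K < 1` is what the inversion of the integral
equation needs up to time one. -/
theorem exists_hamiltonian_of_lipschitz {H : StdSpace n → ℝ} {Q : Set (StdSpace n)}
    (hH : ContDiff ℝ ∞ H) (hs : HasCompactSupport H) (hQ : tsupport H ⊆ Q) {K : NNReal}
    (hL : LipschitzWith K (hamiltonianVectorField H)) (hK : K < 1) :
    ∃ ψ : StdSpace n ≃ StdSpace n, IsHamiltonianSymplectomorphismIn Q ψ ∧
      ∀ γ : ℝ → StdSpace n, (∀ t ∈ Set.Icc (0 : ℝ) 1,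
        HasDerivWithinAt γ (hamiltonianVectorField H (γ t)) (Set.Icc 0 1) t) →
        ψ (γ 0) = γ 1 := by
  let V := hamiltonianVectorField H
  have hV := contDiff_hamiltonianVectorField hH
  have hVs := hasCompactSupport_hamiltonianVectorField hs
  obtain ⟨Φ, hΦ0, hΦs, hΦt, hΦl⟩ := exists_contDiff_flow hV hVs hL hK
  have hL' : LipschitzWith K (-V) := hL.neg
  obtain ⟨Φ', hΦ0', hΦs', hΦt', -⟩ := exists_contDiff_flow hV.neg
    (hVs.comp_left (g := Neg.neg) neg_zero) hL' hK
  have h1 : (1 : ℝ) ∈ Set.Icc (0 : ℝ) 1 := Set.right_mem_Icc.2 zero_le_one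
  have hflow : ∀ γ : ℝ → StdSpace n, (∀ t ∈ Set.Icc (0 : ℝ) 1,
      HasDerivWithinAt γ (V (γ t)) (Set.Icc 0 1) t) → Φ 1 (γ 0) = γ 1 := fun γ hγ =>
    eq_of_integralCurve hL (hΦt (γ 0)) hγ (hΦ0 _)
  have hflow' : ∀ γ : ℝ → StdSpace n, (∀ t ∈ Set.Icc (0 : ℝ) 1,
      HasDerivWithinAt γ (-V (γ t)) (Set.Icc 0 1) t) → Φ' 1 (γ 0) = γ 1 := fun γ hγ =>
    eq_of_integralCurve hL' (hΦt' (γ 0)) hγ (hΦ0' _)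
  let ψ : StdSpace n ≃ StdSpace n :=
    { toFun := Φ 1
      invFun := Φ' 1
      left_inv := fun z => by
        have := hflow' _ (hasDerivWithinAt_reverse (hΦt z))
        simpa [hΦ0] using this
      right_inv := fun z => by
        have := hflow (fun s => Φ' (1 - s) z) fun t ht => by
          have := hasDerivWithinAt_reverse (hΦt' z) t ht
          simpa using this
        simpa [hΦ0'] using this }
  refine ⟨ψ, ⟨⟨hΦs 1 h1, hΦs' 1 h1, fun z u v => ?_⟩, ⟨fun _ => H, Φ, ?_, fun _ _ => hQ, hΦ0,
    fun z t ht => hΦt z t ht, fun _ => rfl⟩, ?_⟩, hflow⟩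
  · have hd : ∀ t ∈ Set.Icc (0 : ℝ) 1, HasDerivWithinAt
        (fun s => stdSymplecticForm (fderiv ℝ (Φ s) z u) (fderiv ℝ (Φ s) z v)) 0
        (Set.Icc 0 1) t := fun t ht => by
      have := (hΦl z u t ht).stdSymplecticForm (hΦl z v t ht)
      rwa [stdSymplecticForm_linearization hH] at this
    have := constant_of_has_deriv_right_zero
      (fun t ht => (hd t ht).continuousWithinAt) (fun t ht =>
        (hd t ⟨ht.1, ht.2.le⟩).mono_of_mem_nhdsWithin (Filter.mem_of_superset
          (Icc_mem_nhdsGE ht.2) (Set.Icc_subset_Icc_left ht.1))) 1 h1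
    refine this.trans ?_
    rw [show Φ 0 = id from funext hΦ0, fderiv_id]
    rfl
  · exact hH.comp contDiff_snd
  · refine (closure_minimal (fun z hz => ?_) (isClosed_tsupport H)).trans hQ
    by_contra hz'
    -- Off the support of `H` the field vanishes, so the constant curve is a trajectory.
    refine hz (hflow (fun _ => z) fun t _ => ?_)
    rw [show V z = 0 from hamiltonianVectorField_eq_zero hz']
    exact hasDerivWithinAt_const _ _ _

theorem IsHamiltonianSymplectomorphismIn.refl (Q : Set (StdSpace n)) :
    IsHamiltonianSymplectomorphismIn Q (Equiv.refl (StdSpace n)) := by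
  refine ⟨⟨contDiff_id, contDiff_id, fun z u v => ?_⟩,
    ⟨fun _ _ => 0, fun _ z => z, contDiff_const, fun t _ => ?_, fun _ => rfl, fun z t _ => ?_,
      fun _ => rfl⟩, ?_⟩
  · rw [Equiv.coe_refl, fderiv_id]
    rfl
  · simp [tsupport]
  · rw [hamiltonianVectorField_eq_zero (by simp [tsupport])]
    exact hasDerivWithinAt_const _ _ _
  · simp

/-- Run the first isotopy, then the second, reparametrized in time; this multiplies the Hamiltonians
by the derivatives of the new clocks. -/
theorem IsHamiltonianTimeOneMap.comp {Q : Set (StdSpace n)} {φ ψ : StdSpace n → StdSpace n}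
    (hψ : IsHamiltonianTimeOneMap Q ψ) (hφ : IsHamiltonianTimeOneMap Q φ) :
    IsHamiltonianTimeOneMap Q (ψ ∘ φ) := by
  obtain ⟨F, Φ, hF, hFs, hΦ0, hΦt, hΦ1⟩ := hφ
  obtain ⟨G, Ψ, hG, hGs, hΨ0, hΨt, hΨ1⟩ := hψ
  -- `σ` reaches one by time `1/3` and `τ` stays zero until `2/3`. Both clocks are at rest in
  -- between, so the concatenation is smooth and near every time at least one of them is constant.
  let σ : ℝ → ℝ := fun t => Real.smoothTransition (3 * t)
  let τ : ℝ → ℝ := fun t => Real.smoothTransition (3 * t - 2)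
  have hσ : ContDiff ℝ ∞ σ := Real.smoothTransition.contDiff.comp (by fun_prop)
  have hτ : ContDiff ℝ ∞ τ := Real.smoothTransition.contDiff.comp (by fun_prop)
  have hσ' : ContDiff ℝ ∞ (deriv σ) := (contDiff_infty_iff_deriv.1 hσ).2
  have hτ' : ContDiff ℝ ∞ (deriv τ) := (contDiff_infty_iff_deriv.1 hτ).2
  have hσI : ∀ t, σ t ∈ Set.Icc (0 : ℝ) 1 := fun t =>
    ⟨Real.smoothTransition.nonneg _, Real.smoothTransition.le_one _⟩
  have hτI : ∀ t, τ t ∈ Set.Icc (0 : ℝ) 1 := fun t =>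
    ⟨Real.smoothTransition.nonneg _, Real.smoothTransition.le_one _⟩
  have hσd : ∀ t, HasDerivAt σ (deriv σ t) t := fun t =>
    (hσ.differentiable (by simp) t).hasDerivAt
  have hτd : ∀ t, HasDerivAt τ (deriv τ t) t := fun t =>
    (hτ.differentiable (by simp) t).hasDerivAt
  have hFd : ∀ t, Differentiable ℝ (F t) := fun t =>
    (hF.comp (contDiff_const.prodMk contDiff_id : ContDiff ℝ ∞ fun z : StdSpace n => (t, z)))
      |>.differentiable (by simp)
  have hGd : ∀ t, Differentiable ℝ (G t) := fun t =>
    (hG.comp (contDiff_const.prodMk contDiff_id : ContDiff ℝ ∞ fun z : StdSpace n => (t, z)))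
      |>.differentiable (by simp)
  have hfield : ∀ t z, hamiltonianVectorField
      (fun z => deriv σ t * F (σ t) z + deriv τ t * G (τ t) z) z =
      deriv σ t • hamiltonianVectorField (F (σ t)) z +
        deriv τ t • hamiltonianVectorField (G (τ t)) z := fun t z => by
    rw [hamiltonianVectorField_add ((hFd _).const_mul _) ((hGd _).const_mul _),
      hamiltonianVectorField_const_mul (hFd _), hamiltonianVectorField_const_mul (hGd _)]
  refine ⟨fun t z => deriv σ t * F (σ t) z + deriv τ t * G (τ t) z,
    fun t z => Ψ (τ t) (Φ (σ t) z), ?_, fun t _ => ?_, fun z => ?_, fun z t ht => ?_, fun z => ?_⟩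
  · refine ((hσ'.comp contDiff_fst).mul (hF.comp ((hσ.comp contDiff_fst).prodMk contDiff_snd))).add
      ((hτ'.comp contDiff_fst).mul (hG.comp ((hτ.comp contDiff_fst).prodMk contDiff_snd)))
  · refine (tsupport_add _ _).trans (Set.union_subset ?_ ?_)
    · exact (tsupport_mul_subset_right (f := fun _ => deriv σ t)).trans (hFs _ (hσI t))
    · exact (tsupport_mul_subset_right (f := fun _ => deriv τ t)).trans (hGs _ (hτI t))
  · have h0 : σ 0 = 0 := Real.smoothTransition.zero_of_nonpos (by norm_num)
    have h0' : τ 0 = 0 := Real.smoothTransition.zero_of_nonpos (by norm_num)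
    simp only [h0, h0', hΦ0, hΨ0]
  · rw [hfield]
    beta_reduce
    rcases lt_or_ge t (2 / 3) with h | h
    · have hev : ∀ᶠ s in nhds t, τ s = 0 := by
        filter_upwards [Iio_mem_nhds h] with s hs
        exact Real.smoothTransition.zero_of_nonpos (by linarith [Set.mem_Iio.1 hs])
      have hz : deriv τ t = 0 := by
        rw [Filter.EventuallyEq.deriv_eq (f := fun _ => (0 : ℝ)) hev]
        simp
      rw [hz, zero_smul, add_zero, hev.self_of_nhds, hΨ0]
      have := (hΦt z (σ t) (hσI t)).scomp t ((hσd t).hasDerivWithinAt (s := Set.Icc 0 1))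
        fun s _ => hσI s
      refine this.congr_of_eventuallyEq ?_ ?_
      · filter_upwards [nhdsWithin_le_nhds hev] with s hs
        rw [hs, hΨ0]
        rfl
      · rw [hev.self_of_nhds, hΨ0]
        rfl
    · have hev : ∀ᶠ s in nhds t, σ s = 1 := by
        filter_upwards [Ioi_mem_nhds (show (1 / 3 : ℝ) < t by linarith)] with s hs
        exact Real.smoothTransition.one_of_one_le (by linarith [Set.mem_Ioi.1 hs])
      have hz : deriv σ t = 0 := by
        rw [Filter.EventuallyEq.deriv_eq (f := fun _ => (1 : ℝ)) hev]
        simp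
      rw [hz, zero_smul, zero_add, hev.self_of_nhds]
      have := (hΨt (Φ 1 z) (τ t) (hτI t)).scomp t ((hτd t).hasDerivWithinAt (s := Set.Icc 0 1))
        fun s _ => hτI s
      refine this.congr_of_eventuallyEq ?_ ?_
      · filter_upwards [nhdsWithin_le_nhds hev] with s hs
        rw [hs]
        rfl
      · rw [hev.self_of_nhds]
        rfl
  · have h0 : σ 1 = 1 := Real.smoothTransition.one_of_one_le (by norm_num)
    have h0' : τ 1 = 1 := Real.smoothTransition.one_of_one_le (by norm_num)
    simp only [h0, h0', hΦ1, hΨ1, Function.comp_apply]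

theorem IsHamiltonianSymplectomorphismIn.trans {Q : Set (StdSpace n)}
    {φ ψ : StdSpace n ≃ StdSpace n} (hφ : IsHamiltonianSymplectomorphismIn Q φ)
    (hψ : IsHamiltonianSymplectomorphismIn Q ψ) :
    IsHamiltonianSymplectomorphismIn Q (φ.trans ψ) := by
  have hφc := hφ.isSymplectomorphism.contDiff
  have hψc := hψ.isSymplectomorphism.contDiff
  refine ⟨⟨hψc.comp hφc, hφ.isSymplectomorphism.contDiff_symm.comp
    hψ.isSymplectomorphism.contDiff_symm, fun z u v => ?_⟩,
    hψ.isHamiltonian.comp hφ.isHamiltonian, ?_⟩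
  · rw [Equiv.coe_trans, fderiv_comp z (hψc.differentiable (by simp) _)
      (hφc.differentiable (by simp) _)]
    exact (hψ.isSymplectomorphism.preserves _ _ _).trans (hφ.isSymplectomorphism.preserves _ _ _)
  · have hsub : {z | (φ.trans ψ) z ≠ z} ⊆ {z | φ z ≠ z} ∪ {z | ψ z ≠ z} := fun z hz => by
      by_contra h
      simp only [Set.mem_union, Set.mem_ofPred_eq, not_or, not_not] at h
      exact hz (by rw [Equiv.trans_apply, h.1, h.2])
    refine (closure_mono hsub).trans ?_
    rw [closure_union]
    exact Set.union_subset hφ.support_subset hψ.support_subset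

/-- A smooth compactly supported function generates a Hamiltonian symplectomorphism. -/
theorem exists_hamiltonian_flow {H : StdSpace n → ℝ} {Q : Set (StdSpace n)}
    (hH : ContDiff ℝ ∞ H) (hs : HasCompactSupport H) (hQ : tsupport H ⊆ Q) :
    ∃ ψ : StdSpace n ≃ StdSpace n, IsHamiltonianSymplectomorphismIn Q ψ ∧
      ∀ γ : ℝ → StdSpace n, (∀ t ∈ Set.Icc (0 : ℝ) 1,
        HasDerivWithinAt γ (hamiltonianVectorField H (γ t)) (Set.Icc 0 1) t) →
        ψ (γ 0) = γ 1 := by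
  obtain ⟨K, hK⟩ := (contDiff_hamiltonianVectorField hH).lipschitzWith_of_hasCompactSupport
    (hasCompactSupport_hamiltonianVectorField hs) (by simp)
  -- With `m > K` the field of `H / m` has Lipschitz constant below one; its time-one map advances
  -- trajectories of `H` by time `1 / m` and is iterated `m` times.
  obtain ⟨m, hm⟩ := exists_nat_gt K
  have hm0 : 0 < m := by
    rcases Nat.eq_zero_or_pos m with h | h
    · rw [h, Nat.cast_zero] at hm
      exact absurd hm not_lt_zero
    · exact h
  have hmR : (0 : ℝ) < m := Nat.cast_pos.2 hm0
  have hfield : ∀ z, hamiltonianVectorField (fun z => (m : ℝ)⁻¹ * H z) z =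
      (m : ℝ)⁻¹ • hamiltonianVectorField H z :=
    hamiltonianVectorField_const_mul (hH.differentiable (by simp)) _
  obtain ⟨φ, hφ, hφγ⟩ := exists_hamiltonian_of_lipschitz (H := fun z => (m : ℝ)⁻¹ * H z) (Q := Q)
    (K := (m : NNReal)⁻¹ * K) (contDiff_const.mul hH) hs.mul_left
    ((tsupport_mul_subset_right (f := fun _ => (m : ℝ)⁻¹)).trans hQ)
    (LipschitzWith.of_dist_le_mul fun x y => by
      rw [hfield, hfield, dist_smul₀, NNReal.coe_mul, mul_assoc]
      simpa using mul_le_mul_of_nonneg_left (hK.dist_le_mul x y) (inv_nonneg.2 hmR.le))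
    (by
      have : (0 : NNReal) < m := Nat.cast_pos.2 hm0
      rw [inv_mul_lt_iff₀ this, mul_one]
      exact hm)
  have key : ∀ k : ℕ, k ≤ m → ∃ ψ : StdSpace n ≃ StdSpace n,
      IsHamiltonianSymplectomorphismIn Q ψ ∧ ∀ γ : ℝ → StdSpace n, (∀ t ∈ Set.Icc (0 : ℝ) 1,
        HasDerivWithinAt γ (hamiltonianVectorField H (γ t)) (Set.Icc 0 1) t) →
        ψ (γ 0) = γ (k / m) := by
    intro k
    induction k with
    | zero => exact fun _ => ⟨_, .refl Q, fun γ _ => by simp⟩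
    | succ k ih =>
      intro hk
      obtain ⟨ψ, hψ, hψγ⟩ := ih (Nat.le_of_succ_le hk)
      refine ⟨ψ.trans φ, hψ.trans hφ, fun γ hγ => ?_⟩
      have hkm : (k : ℝ) + 1 ≤ m := by exact_mod_cast hk
      have hmaps : Set.MapsTo (fun s : ℝ => (k + s) / m) (Set.Icc 0 1) (Set.Icc 0 1) :=
        fun s hs => ⟨div_nonneg (add_nonneg k.cast_nonneg hs.1) hmR.le,
          (div_le_one hmR).2 (by linarith [hs.2])⟩
      rw [Equiv.trans_apply, hψγ γ hγ]
      have := hφγ (fun s => γ ((k + s) / m)) fun t ht => by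
        rw [hfield]
        have hd : HasDerivWithinAt (fun s : ℝ => (k + s) / m) (m : ℝ)⁻¹ (Set.Icc 0 1) t := by
          simpa using (((hasDerivAt_id t).const_add (k : ℝ)).div_const (m : ℝ)).hasDerivWithinAt
        exact (hγ _ (hmaps ht)).scomp t hd hmaps
      simpa using this
  obtain ⟨ψ, hψ, hψγ⟩ := key m le_rfl
  exact ⟨ψ, hψ, fun γ hγ => by simpa [hmR.ne'] using hψγ γ hγ⟩

end HamiltonianFlows

/-! ### Cutoffs in boxes and the three explicit flows. -/

section BoxGeometry

variable {n : ℕ}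

/-- The coordinate `xᵢ`. -/
noncomputable def xCoord (i : Fin n) : StdSpace n →L[ℝ] ℝ :=
  (ContinuousLinearMap.fst ℝ ℝ ℝ).comp (ContinuousLinearMap.proj i)

/-- The coordinate `yᵢ`. -/
noncomputable def yCoord (i : Fin n) : StdSpace n →L[ℝ] ℝ :=
  (ContinuousLinearMap.snd ℝ ℝ ℝ).comp (ContinuousLinearMap.proj i)

/-- The coordinate vector `∂/∂xᵢ`. -/
def xVec (i : Fin n) : StdSpace n := Pi.single i (1, 0)

/-- The coordinate vector `∂/∂yᵢ`. -/
def yVec (i : Fin n) : StdSpace n := Pi.single i (0, 1)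

theorem symplecticDual_xCoord (i : Fin n) : symplecticDual n (xCoord i) = -yVec i := by
  funext j
  by_cases h : j = i
  · subst h
    simp [symplecticDual, xCoord, yVec]
  · simp [symplecticDual, xCoord, yVec, h, Ne.symm h]

theorem symplecticDual_yCoord (i : Fin n) : symplecticDual n (yCoord i) = xVec i := by
  funext j
  by_cases h : j = i
  · subst h
    simp [symplecticDual, yCoord, xVec]
  · simp [symplecticDual, yCoord, xVec, h, Ne.symm h]

variable [NeZero n]

/-- The open analogue of `box`. -/
def openBox (n : ℕ) [NeZero n] (a b : ℝ) : Set (StdSpace n) :=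
  {z | |(z 0).1| < a ∧ |(z 0).2| < b ∧ ∀ i, i ≠ 0 → (z i).1 ^ 2 + (z i).2 ^ 2 < b ^ 2}

theorem isOpen_openBox (a b : ℝ) : IsOpen (openBox n a b) := by
  refine IsOpen.and (isOpen_lt (by fun_prop) continuous_const)
    (IsOpen.and (isOpen_lt (by fun_prop) continuous_const) ?_)
  simp only [Set.ofPred_forall]
  exact isOpen_iInter_of_finite fun i => isOpen_iInter_of_finite fun _ =>
    isOpen_lt (by fun_prop) continuous_const

theorem isClosed_disk2 (r : ℝ) : IsClosed (disk2 r) :=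
  isClosed_le (by fun_prop) continuous_const

theorem abs_le_of_mem_disk2 {r : ℝ} (hr : 0 ≤ r) {p : ℝ × ℝ} (hp : p ∈ disk2 r) :
    |p.1| ≤ r ∧ |p.2| ≤ r := by
  have h : p.1 ^ 2 + p.2 ^ 2 ≤ r ^ 2 := hp
  exact ⟨abs_le_of_sq_le_sq (by nlinarith [sq_nonneg p.2]) hr,
    abs_le_of_sq_le_sq (by nlinarith [sq_nonneg p.1]) hr⟩

theorem isClosed_box (a b : ℝ) : IsClosed (box n a b) := by
  refine IsClosed.and (isClosed_Icc.preimage (f := fun z : StdSpace n => (z 0).1) (by fun_prop))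
    (IsClosed.and (isClosed_Icc.preimage (f := fun z : StdSpace n => (z 0).2) (by fun_prop)) ?_)
  simp only [Set.ofPred_forall]
  exact isClosed_iInter fun i => isClosed_iInter fun _ =>
    (isClosed_disk2 b).preimage (continuous_apply i)

theorem isCompact_box {a b : ℝ} (ha : 0 ≤ a) (hb : 0 ≤ b) : IsCompact (box n a b) := by
  refine Metric.isCompact_of_isClosed_isBounded (isClosed_box a b)
    (Metric.isBounded_closedBall (x := 0) (r := a + b) |>.subset fun z hz => ?_)
  rw [mem_closedBall_zero_iff, pi_norm_le_iff_of_nonneg (by positivity)]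
  intro i
  by_cases hi : i = 0
  · rw [hi]
    exact norm_prod_le_iff.2 ⟨(abs_le.2 hz.1).trans (by linarith),
      (abs_le.2 hz.2.1).trans (by linarith)⟩
  · have := abs_le_of_mem_disk2 hb (hz.2.2 i hi)
    exact norm_prod_le_iff.2 ⟨this.1.trans (by linarith), this.2.trans (by linarith)⟩

theorem openBox_subset_box (a b : ℝ) : openBox n a b ⊆ box n a b := fun _ hz =>
  ⟨abs_le.1 hz.1.le, abs_le.1 hz.2.1.le, fun i hi => (hz.2.2 i hi).le⟩

theorem box_subset_openBox {a b a' b' : ℝ} (hb : 0 ≤ b) (ha' : a < a') (hb' : b < b') :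
    box n a b ⊆ openBox n a' b' := fun _ hz =>
  ⟨(abs_le.2 hz.1).trans_lt ha', (abs_le.2 hz.2.1).trans_lt hb',
    fun i hi => lt_of_le_of_lt (hz.2.2 i hi) (by nlinarith)⟩

theorem mem_openBox_of_abs_le {a b : ℝ} {z w : StdSpace n} (hz : z ∈ openBox n a b)
    (h0 : |(w 0).1| < a ∧ |(w 0).2| < b)
    (h : ∀ i, i ≠ 0 → |(w i).1| ≤ |(z i).1| ∧ |(w i).2| ≤ |(z i).2|) : w ∈ openBox n a b :=
  ⟨h0.1, h0.2, fun i hi => lt_of_le_of_lt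
    (add_le_add (sq_le_sq.2 (h i hi).1) (sq_le_sq.2 (h i hi).2)) (hz.2.2 i hi)⟩

/-- A function that is smooth on a box generates, after cutting off, a Hamiltonian
symplectomorphism supported in the box that follows all of its trajectories in a smaller box. -/
theorem exists_hamiltonian_flow_openBox {a b a' b' : ℝ} (ha : 0 ≤ a) (hb : 0 ≤ b) (haa' : a < a')
    (hbb' : b < b') {F : StdSpace n → ℝ} (hF : ∀ z ∈ box n a' b', ContDiffAt ℝ ∞ F z) :
    ∃ ψ : StdSpace n ≃ StdSpace n, IsHamiltonianSymplectomorphismIn (box n a' b') ψ ∧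
      ∀ γ : ℝ → StdSpace n, (∀ t ∈ Set.Icc (0 : ℝ) 1, γ t ∈ openBox n a b) →
        (∀ t ∈ Set.Icc (0 : ℝ) 1,
          HasDerivWithinAt γ (hamiltonianVectorField F (γ t)) (Set.Icc 0 1) t) →
        ψ (γ 0) = γ 1 := by
  obtain ⟨χ, hχ1, hχ0, -⟩ := exists_contMDiffMap_one_nhds_of_subset_interior (n := ⊤)
    (modelWithCornersSelf ℝ (StdSpace n)) (isClosed_box (n := n) a b)
    ((box_subset_openBox hb haa' hbb').trans
      (interior_maximal (openBox_subset_box a' b') (isOpen_openBox a' b')))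
  have hχ : ContDiff ℝ ∞ χ := χ.contMDiff.contDiff
  let H : StdSpace n → ℝ := fun z => χ z * F z
  have hsupp : tsupport H ⊆ box n a' b' := by
    refine closure_minimal (fun z hz => ?_) (isClosed_box a' b')
    by_contra h
    exact hz (by simp only [H, hχ0 z h, zero_mul])
  -- `F` need only be smooth at points of the closed box, since the product vanishes identically on
  -- its open complement.
  have hH : ContDiff ℝ ∞ H := contDiff_iff_contDiffAt.2 fun z => by
    by_cases hz : z ∈ box n a' b'
    · exact hχ.contDiffAt.mul (hF z hz)
    · refine (contDiffAt_const (c := (0 : ℝ))).congr_of_eventuallyEq ?_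
      filter_upwards [(isClosed_box a' b').isOpen_compl.mem_nhds hz] with w hw
      simp only [H, hχ0 w hw, zero_mul]
  obtain ⟨ψ, hψ, hψγ⟩ := exists_hamiltonian_flow hH
    ((isCompact_box (by linarith) (by linarith)).of_isClosed_subset (isClosed_tsupport H) hsupp)
    hsupp
  refine ⟨ψ, hψ, fun γ hγ hγ' => hψγ γ fun t ht => ?_⟩
  rw [hamiltonianVectorField_congr (G := F)]
  · exact hγ' t ht
  · filter_upwards [Filter.Eventually.filter_mono
      (nhds_le_nhdsSet (openBox_subset_box a b (hγ t ht))) hχ1] with w hw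
    simp only [H, hw, one_mul]

/-- Contraction of the `yᵢ`-axis. -/
theorem exists_hamiltonian_contraction {a b a' b' : ℝ} (ha : 0 ≤ a) (hb : 0 ≤ b) (haa' : a < a')
    (hbb' : b < b') (i : Fin n) {C : ℝ} (hC : 0 ≤ C) :
    ∃ ψ : StdSpace n ≃ StdSpace n, IsHamiltonianSymplectomorphismIn (box n a' b') ψ ∧
      ∀ z ∈ openBox n a b, (z i).1 = 0 →
        ψ z = Function.update z i (0, Real.exp (-C) * (z i).2) := by
  obtain ⟨ψ, hψ, hψγ⟩ := exists_hamiltonian_flow_openBox ha hb haa' hbb'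
    (F := fun z => C * (xCoord i z * yCoord i z)) fun z _ => ContDiff.contDiffAt (by fun_prop)
  refine ⟨ψ, hψ, fun z hz hi => ?_⟩
  -- The left form of the trajectory is convenient to differentiate, the right one to read off
  -- coordinates.
  have hγ : ∀ t : ℝ, z + ((Real.exp (-C * t) - 1) * (z i).2) • yVec i =
      Function.update z i (0, Real.exp (-C * t) * (z i).2) := fun t => by
    funext j
    by_cases h : j = i
    · subst h
      ext
      · simp [yVec, hi]
      · simp [yVec]
        ring
    · simp [yVec, h]
  have h := hψγ (fun t => z + ((Real.exp (-C * t) - 1) * (z i).2) • yVec i)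
    (fun t ht => ?_) fun t _ => ?_
  · have hz0 : z + ((Real.exp (-C * 0) - 1) * (z i).2) • yVec i = z := by simp
    rwa [hz0, hγ, mul_one] at h
  · rw [hγ]
    have he : |Real.exp (-C * t) * (z i).2| ≤ |(z i).2| := by
      rw [abs_mul, Real.abs_exp]
      exact mul_le_of_le_one_left (abs_nonneg _)
        (Real.exp_le_one_iff.2 (by nlinarith [ht.1]))
    have hle : ∀ j, |(Function.update z i (0, Real.exp (-C * t) * (z i).2) j).1| ≤ |(z j).1| ∧
        |(Function.update z i (0, Real.exp (-C * t) * (z i).2) j).2| ≤ |(z j).2| := fun j => by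
      by_cases h : j = i
      · subst h
        simpa [hi] using he
      · simp [h]
    exact mem_openBox_of_abs_le hz ⟨(hle 0).1.trans_lt hz.1, (hle 0).2.trans_lt hz.2.1⟩
      fun j _ => hle j
  · have hd := ((((hasDerivAt_id' t).const_mul (-C)).exp.sub_const 1).mul_const
      (z i).2).smul_const (yVec i) |>.const_add z
    refine hd.hasDerivWithinAt.congr_deriv ?_
    rw [hγ]
    set w := Function.update z i (0, Real.exp (-C * t) * (z i).2) with hw
    have hx : xCoord i w = 0 := by simp [hw, xCoord]
    have hy : yCoord i w = Real.exp (-C * t) * (z i).2 := by simp [hw, yCoord]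
    have hL := ((xCoord i).hasFDerivAt (x := w)).fun_mul (yCoord i).hasFDerivAt |>.const_mul C
    rw [hamiltonianVectorField_eq_dual, hL.fderiv]
    simp only [map_smul, map_add, symplecticDual_xCoord, symplecticDual_yCoord, hx, hy]
    module

/-- Displacement of `x₀` by a function of `xᵢ`. -/
theorem exists_hamiltonian_shear {a b a' b' : ℝ} (ha : 0 ≤ a) (hb : 0 < b) (haa' : a < a')
    (hbb' : b < b') {i : Fin n} (hi : i ≠ 0) {g : ℝ → ℝ}
    (hg : ∀ q, |q| ≤ b' → ContDiffAt ℝ ∞ g q) :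
    ∃ ψ : StdSpace n ≃ StdSpace n, IsHamiltonianSymplectomorphismIn (box n a' b') ψ ∧
      ∀ z ∈ openBox n a b, z 0 = 0 → |g (z i).1| < a →
        ψ z = Function.update z 0 (g (z i).1, 0) := by
  have hdisk : ∀ z ∈ box n a' b', |(z i).1| ≤ b' := fun z hz =>
    (abs_le_of_mem_disk2 (by linarith) (hz.2.2 i hi)).1
  obtain ⟨ψ, hψ, hψγ⟩ := exists_hamiltonian_flow_openBox ha hb.le haa' hbb'
    (F := fun z => yCoord 0 z * g (xCoord i z)) fun z hz =>
      (yCoord 0).contDiff.contDiffAt.mul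
        ((hg _ (hdisk z hz)).comp z (xCoord i).contDiff.contDiffAt)
  refine ⟨ψ, hψ, fun z hz h0 hga => ?_⟩
  have hγ : ∀ t : ℝ, z + (t * g (z i).1) • xVec 0 =
      Function.update z 0 (t * g (z i).1, 0) := fun t => by
    funext j
    by_cases h : j = 0
    · subst h
      ext <;> simp [xVec, h0]
    · simp [xVec, h]
  have hmem : ∀ t ∈ Set.Icc (0 : ℝ) 1, z + (t * g (z i).1) • xVec 0 ∈ openBox n a b :=
    fun t ht => by
      rw [hγ]
      refine mem_openBox_of_abs_le hz ?_ fun j hj => by simp [hj]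
      simp only [Function.update_self, abs_zero, abs_mul]
      refine ⟨lt_of_le_of_lt ?_ hga, hb⟩
      exact mul_le_of_le_one_left (abs_nonneg _) (abs_le.2 ⟨by linarith [ht.1], ht.2⟩)
  have h := hψγ (fun t => z + (t * g (z i).1) • xVec 0) hmem fun t ht => ?_
  · rw [hγ, hγ] at h
    have hz0 : Function.update z 0 ((0 : ℝ) * g (z i).1, (0 : ℝ)) = z := by
      rw [zero_mul]
      exact (congrArg (Function.update z 0) h0.symm).trans (Function.update_eq_self 0 z)
    rwa [hz0, one_mul] at h
  · have hd := (((hasDerivAt_id' t).mul_const (g (z i).1)).smul_const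
      (xVec (0 : Fin n))) |>.const_add z
    refine hd.hasDerivWithinAt.congr_deriv ?_
    set w := z + (t * g (z i).1) • xVec (0 : Fin n) with hw
    have hx : xCoord i w = (z i).1 := by
      rw [hw, hγ]
      simp [xCoord, hi]
    have hy : yCoord 0 w = 0 := by
      rw [hw, hγ]
      simp [yCoord]
    have hbox : w ∈ box n a' b' := openBox_subset_box _ _
      (box_subset_openBox hb.le haa' hbb' (openBox_subset_box _ _ (hmem t ht)))
    have hgd : HasFDerivAt (fun w => g (xCoord i w)) (deriv g (xCoord i w) • xCoord i) w :=
      (((hg _ (hdisk w hbox)).differentiableAt (by simp)).hasDerivAt).comp_hasFDerivAt w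
        (xCoord i).hasFDerivAt
    -- The term containing `g'` carries the factor `y₀`, which is zero along the trajectory, so `yᵢ`
    -- does not move.
    have hL := ((yCoord 0).hasFDerivAt (x := w)).fun_mul hgd
    rw [hamiltonianVectorField_eq_dual, hL.fderiv, hx, hy, zero_smul, zero_add, map_smul, symplecticDual_yCoord, one_mul]

/-- Rotation of `z₀` with angular velocity proportional to `yᵢ`; it moves `xᵢ` to zero on a
suitable hypersurface. -/
theorem exists_hamiltonian_rotation {a b a' b' : ℝ} (ha : 0 ≤ a) (hb : 0 ≤ b) (haa' : a < a')
    (hbb' : b < b') {i : Fin n} (hi : i ≠ 0) (N c : ℝ) :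
    ∃ ψ : StdSpace n ≃ StdSpace n, IsHamiltonianSymplectomorphismIn (box n a' b') ψ ∧
      ∀ z ∈ openBox n a b, (z 0).2 = 0 → N / 2 * (z 0).1 ^ 2 = c - (z i).1 → |(z 0).1| < b →
        ψ z = Function.update (Function.update z 0 ((z 0).1 * Real.cos (N * (z i).2),
          -((z 0).1 * Real.sin (N * (z i).2)))) i (0, (z i).2) := by
  obtain ⟨ψ, hψ, hψγ⟩ := exists_hamiltonian_flow_openBox ha hb haa' hbb'
    (F := fun z => (N / 2 * (xCoord 0 z * xCoord 0 z + yCoord 0 z * yCoord 0 z) - c) *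
      yCoord i z) fun z _ => ContDiff.contDiffAt (by fun_prop)
  refine ⟨ψ, hψ, fun z hz h0 hq hρ => ?_⟩
  set ρ := (z 0).1 with hρdef
  set p := (z i).2 with hp
  have hγ : ∀ t : ℝ, z + ((ρ * Real.cos (N * p * t) - ρ) • xVec 0 +
      (-(ρ * Real.sin (N * p * t))) • yVec 0 + (-((z i).1 * t)) • xVec i) =
      Function.update (Function.update z 0 (ρ * Real.cos (N * p * t),
          -(ρ * Real.sin (N * p * t)))) i ((z i).1 * (1 - t), p) := fun t => by
    funext j
    by_cases h : j = 0
    · subst h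
      ext <;> simp [xVec, yVec, h0, hi.symm, ← hρdef]
    · by_cases h' : j = i
      · subst h'
        ext
        · simp [xVec, yVec, h]
          ring
        · simp [xVec, yVec, h, hp]
      · simp [xVec, yVec, h, h']
  have h := hψγ (fun t => z + ((ρ * Real.cos (N * p * t) - ρ) • xVec 0 +
      (-(ρ * Real.sin (N * p * t))) • yVec 0 + (-((z i).1 * t)) • xVec i))
    (fun t ht => ?_) fun t _ => ?_
  · have hz0 : z + ((ρ * Real.cos (N * p * 0) - ρ) • xVec 0 +
        (-(ρ * Real.sin (N * p * 0))) • yVec 0 + (-((z i).1 * 0)) • xVec i) = z := by simp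
    rwa [hz0, hγ, mul_one, sub_self, mul_zero] at h
  · rw [hγ]
    refine mem_openBox_of_abs_le hz ?_ fun j hj => ?_
    · simp only [Function.update_of_ne hi.symm, Function.update_self, abs_neg, abs_mul]
      exact ⟨lt_of_le_of_lt (mul_le_of_le_one_right (abs_nonneg _) (Real.abs_cos_le_one _)) hz.1,
        lt_of_le_of_lt (mul_le_of_le_one_right (abs_nonneg _) (Real.abs_sin_le_one _)) hρ⟩
    · by_cases h' : j = i
      · subst h'
        simp only [Function.update_self, abs_mul]
        exact ⟨mul_le_of_le_one_right (abs_nonneg _)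
          (abs_le.2 ⟨by linarith [ht.2], by linarith [ht.1]⟩), le_rfl⟩
      · simp [hj, h']
  · have hlin := (hasDerivAt_id' t).const_mul (N * p)
    have hd := ((((hlin.cos.const_mul ρ).sub_const ρ).smul_const (xVec (0 : Fin n))).add
      ((hlin.sin.const_mul ρ).neg.smul_const (yVec (0 : Fin n)))).add
      (((hasDerivAt_id' t).const_mul (z i).1).neg.smul_const (xVec i)) |>.const_add z
    refine hd.hasDerivWithinAt.congr_deriv ?_
    rw [hγ]
    set w := Function.update (Function.update z 0 (ρ * Real.cos (N * p * t),
          -(ρ * Real.sin (N * p * t)))) i ((z i).1 * (1 - t), p) with hw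
    have hx : xCoord 0 w = ρ * Real.cos (N * p * t) := by simp [hw, xCoord, hi.symm]
    have hy : yCoord 0 w = -(ρ * Real.sin (N * p * t)) := by simp [hw, yCoord, hi.symm]
    have hyi : yCoord i w = p := by simp [hw, yCoord]
    have hL := (((((xCoord 0).hasFDerivAt (x := w)).fun_mul (xCoord 0).hasFDerivAt).fun_add
      ((yCoord 0).hasFDerivAt.fun_mul (yCoord 0).hasFDerivAt)).const_mul (N / 2)
        |>.sub_const c).fun_mul (yCoord i).hasFDerivAt
    -- Rotation preserves `|z₀|² = ρ²`, so by `hq` the velocity of `xᵢ` is the constant `-(z i).1`.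
    have hr2 : N / 2 * (ρ * Real.cos (N * p * t) * (ρ * Real.cos (N * p * t)) +
        -(ρ * Real.sin (N * p * t)) * -(ρ * Real.sin (N * p * t))) - c = -(z i).1 := by
      linear_combination hq + N / 2 * ρ ^ 2 * Real.sin_sq_add_cos_sq (N * p * t)
    rw [hamiltonianVectorField_eq_dual, hL.fderiv]
    simp only [map_smul, map_add, symplecticDual_xCoord, symplecticDual_yCoord, hx, hy, hyi, hr2]
    module

end BoxGeometry

/-! ### Squeezing the disk factors one at a time. -/

section Squeezing

theorem exists_exp_neg_mul_lt {r η : ℝ} (hr : 0 < r) (hη : 0 < η) :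
    ∃ C, 0 ≤ C ∧ Real.exp (-C) * r < η := by
  refine ⟨r / η, by positivity, ?_⟩
  have h : r / η < Real.exp (r / η) := by linarith [Real.add_one_le_exp (r / η)]
  rw [Real.exp_neg, inv_mul_lt_iff₀ (Real.exp_pos _)]
  rwa [div_lt_iff₀ hη] at h

variable {n : ℕ}

/-- The set of points whose factors with index in `A` lie in the disk of radius `r` and whose
other factors vanish. -/
def partialPolydisk (A : Finset (Fin n)) (r : ℝ) : Set (StdSpace n) :=
  {z | ∀ i, if i ∈ A then z i ∈ disk2 r else z i = 0}

theorem isCompact_partialPolydisk (A : Finset (Fin n)) {r : ℝ} (hr : 0 ≤ r) :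
    IsCompact (partialPolydisk A r) := by
  have h : partialPolydisk A r =
      Set.pi Set.univ fun i => if i ∈ A then disk2 r else {(0 : ℝ × ℝ)} := by
    ext z
    simp only [partialPolydisk, Set.mem_ofPred_eq, Set.mem_univ_pi]
    refine forall_congr' fun i => ?_
    split_ifs <;> simp
  rw [h]
  refine isCompact_univ_pi fun i => ?_
  split_ifs
  · refine Metric.isCompact_of_isClosed_isBounded (isClosed_disk2 r)
      (Metric.isBounded_closedBall (x := 0) (r := r) |>.subset fun p hp => ?_)
    exact mem_closedBall_zero_iff.2 (norm_prod_le_iff.2 (abs_le_of_mem_disk2 hr hp))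
  · exact isCompact_singleton

variable [NeZero n]

/-- The `i`-th disk factor over `z₀ = 0` can be squeezed into a small neighbourhood of the
origin, at the cost of a small displacement of `z₀`. -/
theorem exists_hamiltonian_squeeze_factor {r ε η : ℝ} (hr : 0 < r) (hε : 0 < ε) (hη : 0 < η)
    {i : Fin n} (hi : i ≠ 0) :
    ∃ ψ : StdSpace n ≃ StdSpace n, IsHamiltonianSymplectomorphismIn (box n ε (r + ε)) ψ ∧
      ∀ z : StdSpace n, z 0 = 0 → (∀ j, j ≠ 0 → z j ∈ disk2 r) →
        (∀ j, j ≠ 0 → j ≠ i → ψ z j = z j) ∧ ‖ψ z 0‖ < η ∧ ‖ψ z i‖ < η := by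
  set a := ε / 2 with ha
  set b := r + ε / 2 with hb
  have ha0 : 0 < a := by positivity
  have hb0 : 0 < b := by positivity
  have haε : a < ε := by linarith
  have hbε : b < r + ε := by linarith
  -- `θ` bounds the radius of `z₀`: below `a` and `b` the trajectories stay in the inner box, and
  -- below `η` the final displacement is small enough.
  obtain ⟨θ, hθ0, hθa, hθb, hθη⟩ : ∃ θ : ℝ, 0 < θ ∧ θ < a ∧ θ < b ∧ θ < η := by
    obtain ⟨θ, h0, h⟩ := exists_between (lt_min ha0 (lt_min hb0 hη))
    exact ⟨θ, h0, h.trans_le (min_le_left _ _),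
      h.trans_le ((min_le_right _ _).trans (min_le_left _ _)),
      h.trans_le ((min_le_right _ _).trans (min_le_right _ _))⟩
  -- This keeps `c - q` positive for `|q| ≤ r + ε`, so the square root is smooth over the whole
  -- outer box.
  set c := r + ε + 1 with hc
  have hc0 : 0 < c := by positivity
  -- Chosen so that `N / 2 * θ ^ 2 = 2 * c`, which dominates `c - q` for `|q| ≤ r`; hence `g ≤ θ`
  -- there.
  set N := 4 * c / θ ^ 2 with hN
  have hN0 : 0 < N := by positivity
  let g : ℝ → ℝ := fun q => Real.sqrt (2 * (c - q) / N)
  have hgpos : ∀ q, |q| ≤ r + ε → 0 < 2 * (c - q) / N := fun q hq => by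
    have : 0 < c - q := by linarith [(abs_le.1 hq).2]
    positivity
  have hg : ∀ q, |q| ≤ r + ε → ContDiffAt ℝ ∞ g q := fun q hq =>
    ContDiffAt.sqrt (ContDiff.contDiffAt (by fun_prop)) (hgpos q hq).ne'
  have hgsq : ∀ q, |q| ≤ r + ε → N / 2 * g q ^ 2 = c - q := fun q hq => by
    rw [Real.sq_sqrt (hgpos q hq).le]
    field_simp
  have hgθ : ∀ q, |q| ≤ r → |g q| ≤ θ := fun q hq => by
    refine abs_le_of_sq_le_sq ?_ hθ0.le
    have h1 := hgsq q (by linarith)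
    have h2 : c - q ≤ 2 * c := by linarith [(abs_le.1 hq).1]
    have h3 : N / 2 * θ ^ 2 = 2 * c := by
      rw [hN]
      field_simp
      norm_num
    have h4 : N / 2 * g q ^ 2 ≤ N / 2 * θ ^ 2 := by linarith
    exact le_of_mul_le_mul_left h4 (by positivity)
  obtain ⟨C, hC0, hC⟩ := exists_exp_neg_mul_lt hr hη
  obtain ⟨ψ₁, hψ₁, h₁⟩ := exists_hamiltonian_shear ha0.le hb0 haε hbε hi hg
  obtain ⟨ψ₂, hψ₂, h₂⟩ := exists_hamiltonian_rotation ha0.le hb0.le haε hbε hi N c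
  obtain ⟨ψ₃, hψ₃, h₃⟩ := exists_hamiltonian_contraction ha0.le hb0.le haε hbε i hC0
  refine ⟨(ψ₁.trans ψ₂).trans ψ₃, (hψ₁.trans hψ₂).trans hψ₃, fun z h0 hz => ?_⟩
  have hzi := abs_le_of_mem_disk2 hr.le (hz i hi)
  have hρ := hgθ _ hzi.1
  have hzU : z ∈ openBox n a b := by
    refine ⟨by simpa [h0] using ha0, by simpa [h0] using hb0, fun j hj => ?_⟩
    exact lt_of_le_of_lt (hz j hj) (by nlinarith)
  have e₁ := h₁ z hzU h0 (hρ.trans_lt hθa)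
  set ρ := g (z i).1
  have hwU : Function.update z 0 (ρ, 0) ∈ openBox n a b := by
    refine mem_openBox_of_abs_le hzU ?_ fun j hj => by simp [hj]
    simpa using ⟨hρ.trans_lt hθa, hb0⟩
  have e₂ := h₂ _ hwU (by simp) (by simpa [hi] using hgsq _ (hzi.1.trans (by linarith)))
    (by simpa using hρ.trans_lt hθb)
  simp only [Function.update_self, Function.update_of_ne hi, Function.update_idem] at e₂
  set x' := ρ * Real.cos (N * (z i).2)
  set y' := -(ρ * Real.sin (N * (z i).2))
  have hx' : |x'| ≤ θ := by
    rw [abs_mul]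
    exact (mul_le_of_le_one_right (abs_nonneg _) (Real.abs_cos_le_one _)).trans hρ
  have hy' : |y'| ≤ θ := by
    rw [abs_neg, abs_mul]
    exact (mul_le_of_le_one_right (abs_nonneg _) (Real.abs_sin_le_one _)).trans hρ
  have hvU : Function.update (Function.update z 0 (x', y')) i (0, (z i).2) ∈ openBox n a b := by
    refine mem_openBox_of_abs_le hzU ?_ fun j hj => ?_
    · simpa [hi.symm] using ⟨hx'.trans_lt hθa, hy'.trans_lt hθb⟩
    · by_cases h : j = i
      · subst h
        simp
      · simp [h, hj]
  have e₃ := h₃ _ hvU (by simp)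
  simp only [Equiv.trans_apply, e₁, e₂, e₃]
  refine ⟨fun j hj hji => by simp [hj, hji], ?_, ?_⟩
  · simp only [Function.update_of_ne hi.symm, Function.update_self]
    exact max_lt (hx'.trans_lt hθη) (hy'.trans_lt hθη)
  · simp only [Function.update_self]
    refine max_lt (by simpa using hη) ?_
    rw [Real.norm_eq_abs, abs_mul, Real.abs_exp]
    exact lt_of_le_of_lt (mul_le_mul_of_nonneg_left hzi.2 (Real.exp_pos _).le) hC

/-- Induction on the number of nonzero factors. The map `ψ` for the smaller set sends a whole
`η`-neighbourhood of its compact polydisk into `U`; squeezing one more factor first, with accuracy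
`η`, lands in that neighbourhood. -/
theorem exists_hamiltonian_squeeze_partialPolydisk {r ε : ℝ} (hr : 0 < r) (hε : 0 < ε)
    {U : Set (StdSpace n)} (hU : IsOpen U) (h0U : (0 : StdSpace n) ∈ U) (A : Finset (Fin n)) :
    0 ∉ A → ∃ ψ : StdSpace n ≃ StdSpace n,
      IsHamiltonianSymplectomorphismIn (box n ε (r + ε)) ψ ∧
        ∀ z ∈ partialPolydisk A r, ψ z ∈ U := by
  induction A using Finset.induction_on with
  | empty =>
    refine fun _ => ⟨_, .refl _, fun z hz => ?_⟩
    rwa [show z = 0 from funext fun i => by simpa using hz i]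
  | insert i A hiA ih =>
    intro h0
    rw [Finset.mem_insert, not_or] at h0
    have hi : i ≠ 0 := Ne.symm h0.1
    obtain ⟨ψ, hψ, hψU⟩ := ih h0.2
    obtain ⟨η, hη, hsub⟩ := (isCompact_partialPolydisk A hr.le).exists_thickening_subset_open
      (hU.preimage hψ.isSymplectomorphism.contDiff.continuous) hψU
    obtain ⟨φ, hφ, hφz⟩ := exists_hamiltonian_squeeze_factor hr hε hη hi
    refine ⟨φ.trans ψ, hφ.trans hψ, fun z hz => hsub ?_⟩
    have hz0 : z 0 = 0 := by simpa [hi.symm, h0.2] using hz 0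
    have hdisk : ∀ j, j ≠ 0 → z j ∈ disk2 r := fun j _ => by
      have := hz j
      split_ifs at this
      · exact this
      · rw [this]
        simpa [disk2] using sq_nonneg r
    obtain ⟨hφj, hφ0, hφi⟩ := hφz z hz0 hdisk
    rw [Metric.mem_thickening_iff]
    -- The nearby point forgets the `i`-th factor; the squeeze moves only the factors `0` and `i`,
    -- and leaves both within `η` of zero.
    refine ⟨Function.update z i 0, fun j => ?_, ?_⟩
    · by_cases hj : j = i
      · subst hj
        simp [hiA]
      · simpa [hj] using hz j
    · refine (dist_pi_lt_iff hη).2 fun j => ?_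
      by_cases hj : j = i
      · subst hj
        simpa using hφi
      · by_cases hj0 : j = 0
        · subst hj0
          simpa [hj, hz0] using hφ0
        · simpa [hj, hφj j hj0 hj] using hη

end Squeezing

theorem mainTheorem5 (n : ℕ) [NeZero n] (r ε δ : ℝ) (hr : 0 < r) (hε : 0 < ε) (hδ : 0 < δ) :
    ∃ ψ : StdSpace n ≃ StdSpace n,
      IsHamiltonianSymplectomorphismIn (box n ε (r + ε)) ψ ∧
        ψ '' thinDisk n r ⊆ polydisk (fun _ => δ) := by
  let U : Set (StdSpace n) := {z | ∀ i, (z i).1 ^ 2 + (z i).2 ^ 2 < δ ^ 2}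
  have hU : IsOpen U := by
    simp only [U, Set.ofPred_forall]
    exact isOpen_iInter_of_finite fun i => isOpen_lt (by fun_prop) continuous_const
  have h0U : (0 : StdSpace n) ∈ U := fun i => by simpa using pow_pos hδ 2
  let A : Finset (Fin n) := Finset.univ.erase 0
  obtain ⟨ψ, hψ, hψU⟩ := exists_hamiltonian_squeeze_partialPolydisk hr hε hU h0U A (by simp [A])
  obtain ⟨η, hη, hsub⟩ := (isCompact_partialPolydisk A hr.le).exists_thickening_subset_open
    (hU.preimage hψ.isSymplectomorphism.contDiff.continuous) hψU
  obtain ⟨C, hC0, hC⟩ := exists_exp_neg_mul_lt hr hη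
  obtain ⟨φ, hφ, hφz⟩ := exists_hamiltonian_contraction (n := n) (a := ε / 2) (b := r + ε / 2)
    (a' := ε) (b' := r + ε) (by positivity) (by positivity) (by linarith) (by linarith) 0 hC0
  refine ⟨φ.trans ψ, hφ.trans hψ, ?_⟩
  rintro _ ⟨z, ⟨hx, hy, hz⟩, rfl⟩ i
  have hy' : |(z 0).2| ≤ r := abs_le.2 hy
  have hzU : z ∈ openBox n (ε / 2) (r + ε / 2) :=
    ⟨by simpa [hx] using hε, by linarith, fun j hj => lt_of_le_of_lt (hz j hj) (by nlinarith)⟩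
  have hthick : φ z ∈ Metric.thickening η (partialPolydisk A r) := by
    rw [Metric.mem_thickening_iff]
    -- Only `y₀` is nonzero in the `0`-th factor, and the contraction makes it smaller than `η`.
    refine ⟨Function.update z 0 0, fun j => ?_, ?_⟩
    · by_cases hj : j = 0
      · subst hj
        simp [A]
      · simpa [A, hj] using hz j hj
    · rw [hφz z hzU hx]
      refine (dist_pi_lt_iff hη).2 fun j => ?_
      by_cases hj : j = 0
      · subst hj
        rw [Function.update_self, Function.update_self, dist_zero_right]
        refine max_lt (by simpa using hη) ?_
        rw [Real.norm_eq_abs, abs_mul, Real.abs_exp]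
        exact lt_of_le_of_lt (mul_le_mul_of_nonneg_left hy' (Real.exp_pos _).le) hC
      · simpa [hj] using hη
  exact (hsub hthick i).le
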